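/- Let $k\ge 2$ and let $P_k=\mathbb F_2[x_1,\dots,x_k]$ ($\deg x_i=1$), regarded as a module over the mod-2 Steenrod algebra $\mathcal A$ in the usual way ($P_k=H^*(BV_k;\mathbb F_2)$ for $V_k$ an elementary abelian 2-group of rank $k$), with $GL_k=GL_k(\mathbb F_2)$ acting by linear substitutions of the variables. Let $\mathbb F_2\otimes_{\mathcal A}P_k=P_k/\mathcal A^+P_k$ with the inherited $GL_k$-action, where $\mathcal A^+$ is the ideal of elements of positive degree, and let $(\mathbb F_2\otimes_{\mathcal A}P_k)_n$ be the subspace of classes of homogeneous polynomials of degree $n$. Kameko's squaring operation $$\widetilde{Sq}^0_*:(\mathbb F_2\otimes_{\mathcal A}P_k)_{2d+k}\longrightarrow(\mathbb F_2\otimes_{\mathcal A}P_k)_d$$ is induced by the $\mathbb F_2$-linear map $\phi:P_k\to P_k$ with $\phi(x)=y$ if $x=x_1x_2\cdots x_ky^2$ for a monomial $y$, and $\phi(x)=0$ for every other monomial $x$. For non-negative integers $d$ and $s\ge t$ write $$K_{t,s,d}=(\widetilde{Sq}^0_*)^{s-t}:(\mathbb F_2\otimes_{\mathcal A}P_k)_{k(2^s-1)+2^sd}\longrightarrow(\mathbb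 F_2\otimes_{\mathcal A}P_k)_{k(2^t-1)+2^td}.$$ For $n>0$ let $\alpha(n)$ be the number of ones in the dyadic expansion of $n$, let $\zeta(n)$ be the greatest $u$ with $2^u\mid n$, and set $t(k,d)=\max\{0,\,k-\alpha(d+k)-\zeta(d+k)\}$. Then: 1. For every $d\ge 0$ and every $s\ge k-2$, the map $K_{k-2,s,d}$ is an isomorphism of $GL_k$-modules. 2. $k-2$ is the minimal uniform bound: it is the least integer $t\ge 0$ such that $K_{t,s,d}$ is an isomorphism of $GL_k$-modules for all $d\ge 0$ and all $s\ge t$. 3. For the degree $d=2^k-k+1$ one has $t(k,d)=k-2$, and already for this single $d$, $k-2$ is the least integer $t\ge 0$ such that $K_{t,s,d}$ is an isomorphism of $GL_k$-modules for all $s\ge t$. -/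

import Mathlib

namespace Kameko

open MvPolynomial

/-- The polynomial algebra `P_k = 𝔽₂[x_1, …, x_k] = H^*(BV_k; 𝔽₂)`. -/
abbrev P (k : ℕ) : Type := MvPolynomial (Fin k) (ZMod 2)

/-! ### Steenrod squares -/

/-- The total Steenrod square `f ↦ ∑_i Sq^i(f) T^i`: the ring homomorphism (Cartan formula) which on
the generators of degree one is `x ↦ x + x² T`, i.e. `Sq^0 x = x`, `Sq^1 x = x²`, `Sq^i x = 0` for
`i ≥ 2`. -/
noncomputable def totalSq (k : ℕ) : P k →ₐ[ZMod 2] Polynomial (P k) :=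
  aeval fun j => Polynomial.C (X j) + Polynomial.C (X j ^ 2) * Polynomial.X

/-- The Steenrod square `Sq^i : P_k → P_k`. -/
noncomputable def Sq (k i : ℕ) : Module.End (ZMod 2) (P k) where
  toFun f := (totalSq k f).coeff i
  map_add' f g := by simp
  map_smul' c f := by simp

/-- The operators on `P_k` given by the elements of `𝒜^+`, the ideal of positive-degree elements of
the Steenrod algebra: sums of products of `Sq^i`, `i ≥ 1`. -/
noncomputable def positiveOps (k : ℕ) :
    NonUnitalSubalgebra (ZMod 2) (Module.End (ZMod 2) (P k)) :=
  NonUnitalAlgebra.adjoin (ZMod 2) {θ | ∃ i, 1 ≤ i ∧ θ = Sq k i}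

/-- The subspace `𝒜^+ P_k` of hit polynomials. -/
noncomputable def hit (k : ℕ) : Submodule (ZMod 2) (P k) :=
  Submodule.span (ZMod 2) {h | ∃ θ ∈ positiveOps k, ∃ f : P k, h = θ f}

/-- `𝔽₂ ⊗_𝒜 P_k = P_k / 𝒜^+ P_k`. -/
abbrev Q (k : ℕ) : Type := P k ⧸ hit k

theorem Sq_mem_hit {k i : ℕ} (hi : 1 ≤ i) (f : P k) : Sq k i f ∈ hit k :=
  Submodule.subset_span
    ⟨Sq k i, NonUnitalAlgebra.subset_adjoin (ZMod 2) ⟨i, hi, rfl⟩, f, rfl⟩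

theorem hit_le {k : ℕ} {W : Submodule (ZMod 2) (P k)}
    (h : ∀ i, 1 ≤ i → ∀ f : P k, Sq k i f ∈ W) : hit k ≤ W := by
  refine Submodule.span_le.2 ?_
  rintro _ ⟨θ, hθ, f, rfl⟩
  change θ f ∈ W
  induction hθ using NonUnitalAlgebra.adjoin_induction generalizing f with
  | mem x hx => obtain ⟨i, hi, rfl⟩ := hx; exact h i hi f
  | add x y _ _ hx hy => exact W.add_mem (hx f) (hy f)
  | zero => exact W.zero_mem
  | mul x y _ _ hx _ => exact hx (y f)
  | smul r x _ hx => exact W.smul_mem r (hx f)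

/-! ### The action of the general linear group -/

/-- `GL_k = GL_k(𝔽₂)`. -/
abbrev GLk (k : ℕ) : Type := GL (Fin k) (ZMod 2)

/-- The linear substitution `x_j ↦ ∑_i g_{ij} x_i`. -/
noncomputable def subst (k : ℕ) (g : GLk k) : P k →ₐ[ZMod 2] P k :=
  aeval fun j => ∑ i, C ((g : Matrix (Fin k) (Fin k) (ZMod 2)) i j) * X i

theorem subst_X (k : ℕ) (g : GLk k) (j : Fin k) :
    subst k g (X j) = ∑ i, C ((g : Matrix (Fin k) (Fin k) (ZMod 2)) i j) * X i := by
  simp [subst]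

/-- The action of `GL_k` on `P_k` by linear substitutions. -/
noncomputable def polyRep (k : ℕ) : Representation (ZMod 2) (GLk k) (P k) where
  toFun g := (subst k g).toLinearMap
  map_one' := by
    have h : subst k 1 = AlgHom.id (ZMod 2) (P k) := by
      refine MvPolynomial.algHom_ext fun j => ?_
      rw [subst_X]
      simp [Matrix.one_apply]
    rw [h]; rfl
  map_mul' g h := by
    have h : subst k (g * h) = (subst k g).comp (subst k h) := by
      refine MvPolynomial.algHom_ext fun j => ?_
      simp only [subst_X, AlgHom.comp_apply, map_sum, map_mul, algHom_C, Units.val_mul,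
        Matrix.mul_apply, Finset.sum_mul, Finset.mul_sum, MvPolynomial.algebraMap_eq]
      rw [Finset.sum_comm]
      refine Finset.sum_congr rfl fun i _ => Finset.sum_congr rfl fun l _ => ?_
      ring
    rw [h]; rfl

theorem totalSq_subst (k : ℕ) (g : GLk k) (f : P k) :
    totalSq k (subst k g f) = (totalSq k f).map (subst k g).toRingHom := by
  have h : (totalSq k).comp (subst k g) = (Polynomial.mapAlgHom (subst k g)).comp (totalSq k) := by
    refine MvPolynomial.algHom_ext fun j => ?_
    have hc : ∀ a : ZMod 2, a ^ 2 = a := by decide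
    have hsq : (∑ i, C ((g : Matrix (Fin k) (Fin k) (ZMod 2)) i j) * X i : P k) ^ 2
        = ∑ i, C ((g : Matrix (Fin k) (Fin k) (ZMod 2)) i j) * X i ^ 2 := by
      rw [sum_pow_char 2]
      refine Finset.sum_congr rfl fun i _ => ?_
      rw [mul_pow, ← C_pow, hc]
    have hX : ∀ i, totalSq k (X i)
        = Polynomial.C (X i) + Polynomial.C (X i ^ 2) * Polynomial.X := fun i => by simp [totalSq]
    rw [AlgHom.comp_apply, AlgHom.comp_apply, subst_X, hX]
    simp only [map_sum, map_mul, map_add, map_pow, hX, Polynomial.coe_mapAlgHom,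
      Polynomial.map_C, Polynomial.map_X, RingHom.coe_coe, subst_X]
    simp only [← map_sum, ← map_mul, ← map_pow, hsq]
    simp only [algHom_C, mul_add, Finset.sum_add_distrib, map_sum, map_mul, map_pow,
      Finset.sum_mul, mul_assoc]
    rfl
  exact DFunLike.congr_fun h f

theorem hit_le_comap_polyRep (k : ℕ) (g : GLk k) : hit k ≤ (hit k).comap (polyRep k g) := by
  refine hit_le fun i hi f => ?_
  have h : polyRep k g (Sq k i f) = Sq k i (polyRep k g f) := by
    change subst k g ((totalSq k f).coeff i) = (totalSq k (subst k g f)).coeff i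
    rw [totalSq_subst, Polynomial.coeff_map]
    rfl
  rw [Submodule.mem_comap, h]
  exact Sq_mem_hit hi _

/-- The inherited action of `GL_k` on `𝔽₂ ⊗_𝒜 P_k`. -/
noncomputable def qRep (k : ℕ) : Representation (ZMod 2) (GLk k) (Q k) :=
  (polyRep k).quotient (hit k) (hit_le_comap_polyRep k)

/-- `(𝔽₂ ⊗_𝒜 P_k)_n`: the classes represented by homogeneous polynomials of degree `n`. -/
noncomputable def qDeg (k n : ℕ) : Submodule (ZMod 2) (Q k) :=
  (homogeneousSubmodule (Fin k) (ZMod 2) n).map (hit k).mkQ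

theorem qDeg_le_comap (k n : ℕ) (g : GLk k) : qDeg k n ≤ (qDeg k n).comap (qRep k g) := by
  rintro _ ⟨f, hf, rfl⟩
  refine ⟨subst k g f, ?_, rfl⟩
  have hf' : f.IsHomogeneous n := hf
  have := hf'.aeval (fun j => ∑ i, C ((g : Matrix (Fin k) (Fin k) (ZMod 2)) i j) * X i) (n := 1)
    fun j => IsHomogeneous.sum _ _ _ fun i _ => isHomogeneous_C_mul_X _ _
  rw [one_mul] at this
  exact this

/-- The `GL_k`-module `(𝔽₂ ⊗_𝒜 P_k)_n`. -/
noncomputable def degRep (k n : ℕ) : Representation (ZMod 2) (GLk k) (qDeg k n) :=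
  (qRep k).subrepresentation (qDeg k n) (qDeg_le_comap k n)

/-! ### Kameko's squaring operation -/

/-- The linear map `φ : P_k → P_k` with `φ(x) = y` if `x = x_1 ⋯ x_k y²`, and `φ(x) = 0` for every
other monomial `x`. -/
noncomputable def phi (k : ℕ) : P k →ₗ[ZMod 2] P k :=
  (basisMonomials (Fin k) (ZMod 2)).constr (ZMod 2) fun m =>
    if ∀ i, Odd (m i) then monomial (m.mapRange (fun a => a / 2) rfl) 1 else 0

theorem phi_monomial (k : ℕ) (m : Fin k →₀ ℕ) :
    phi k (monomial m 1) =
      if ∀ i, Odd (m i) then monomial (m.mapRange (fun a => a / 2) rfl) 1 else 0 := by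
  have := (basisMonomials (Fin k) (ZMod 2)).constr_basis (ZMod 2)
    (fun m : Fin k →₀ ℕ => if ∀ i, Odd (m i) then
      (monomial (m.mapRange (fun a => a / 2) rfl) 1 : P k) else 0) m
  rwa [coe_basisMonomials] at this

theorem monomial_eq_smul {k : ℕ} (m : Fin k →₀ ℕ) (c : ZMod 2) :
    (monomial m c : P k) = c • monomial m 1 := by
  rw [smul_monomial, smul_eq_mul, mul_one]

theorem phi_mul_sq (k : ℕ) (a b : P k) : phi k (a * b ^ 2) = phi k a * b := by
  have key : ∀ m n : Fin k →₀ ℕ, phi k (monomial m 1 * monomial n 1 ^ 2)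
      = phi k (monomial m 1) * monomial n 1 := by
    intro m n
    rw [sq, monomial_mul, monomial_mul, one_mul, one_mul, phi_monomial, phi_monomial]
    have hodd : (∀ i, Odd ((m + (n + n)) i)) ↔ ∀ i, Odd (m i) := by
      refine forall_congr' fun i => ?_
      simp only [Finsupp.add_apply, Nat.odd_iff]
      omega
    by_cases h : ∀ i, Odd (m i)
    · rw [if_pos (hodd.2 h), if_pos h, monomial_mul, one_mul]
      congr 2
      ext i
      simp only [Finsupp.mapRange_apply, Finsupp.add_apply]
      omega
    · rw [if_neg (fun h' => h (hodd.1 h')), if_neg h, zero_mul]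
  have key2 : ∀ (n : Fin k →₀ ℕ) (a : P k), phi k (a * monomial n 1 ^ 2)
      = phi k a * monomial n 1 := by
    intro n a
    induction a using MvPolynomial.monomial_add_induction_on with
    | C c =>
      have := key 0 n
      rw [C_apply, monomial_eq_smul 0 c, smul_mul_assoc, map_smul, this,
        map_smul, smul_mul_assoc]
    | monomial_add m c f _ _ hf =>
      rw [monomial_eq_smul m c, add_mul, map_add, map_add, add_mul, hf,
        smul_mul_assoc, map_smul, map_smul, key, smul_mul_assoc]
  induction b using MvPolynomial.induction_on' with
  | monomial n c =>
    have hc : c ^ 2 = c := by revert c; decide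
    rw [monomial_eq_smul n c, smul_pow, hc, mul_smul_comm, map_smul, key2,
      mul_smul_comm]
  | add p q hp hq => rw [add_pow_char, mul_add, map_add, hp, hq, mul_add]

theorem phi_coeff_totalSq_prod (k : ℕ) (E : Finset (Fin k)) (l : ℕ) :
    phi k ((totalSq k (∏ i ∈ E, X i)).coeff l) = if l = 0 then phi k (∏ i ∈ E, X i) else 0 := by
  have hX : ∀ i, totalSq k (X i)
      = Polynomial.C (X i) + Polynomial.C (X i ^ 2) * Polynomial.X := fun i => by simp [totalSq]
  rcases Nat.eq_zero_or_pos l with rfl | hl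
  · rw [map_prod, Polynomial.coeff_zero_prod]
    simp [hX]
  rw [if_neg hl.ne', map_prod]
  simp only [hX]
  rw [Finset.prod_add, Polynomial.finsetSum_coeff, map_sum]
  refine Finset.sum_eq_zero fun S hS => ?_
  rw [Finset.prod_mul_distrib, Finset.prod_const, ← map_prod, ← map_prod, ← mul_assoc, ← map_mul,
    Polynomial.coeff_C_mul_X_pow]
  split_ifs with h
  · obtain ⟨j, hj⟩ : (E \ S).Nonempty := Finset.card_pos.1 (h ▸ hl)
    have hjS : j ∉ S := (Finset.mem_sdiff.1 hj).2
    rw [Finset.prod_pow, phi_mul_sq]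
    have hm : (∏ i ∈ S, X i : P k) = monomial (∑ i ∈ S, Finsupp.single i 1) 1 := by
      simp only [X, monomial_sum_one]
    rw [hm, phi_monomial, if_neg, zero_mul]
    intro hall
    have := hall j
    rw [Finsupp.finsetSum_apply, Finset.sum_eq_zero] at this
    · simp at this
    · intro i hi
      exact Finsupp.single_eq_of_ne (by rintro rfl; exact hjS hi)
  · exact map_zero _

/-- `φ Sq^{2i} = Sq^i φ` and `φ Sq^{2i+1} = 0`. -/
theorem phi_Sq (k j : ℕ) (f : P k) :
    phi k (Sq k j f) = if Even j then Sq k (j / 2) (phi k f) else 0 := by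
  induction f using MvPolynomial.induction_on' with
  | add p q hp hq =>
    rw [map_add, map_add, hp, hq, map_add, map_add]
    split_ifs <;> simp
  | monomial m c =>
    rw [monomial_eq_smul m c]
    suffices H : phi k (Sq k j (monomial m 1))
        = if Even j then Sq k (j / 2) (phi k (monomial m 1)) else 0 by
      rw [map_smul, map_smul, H, map_smul, map_smul]
      split_ifs <;> simp
    set E : Finset (Fin k) := Finset.univ.filter fun i => Odd (m i) with hE
    set g : P k := monomial (m.mapRange (fun a => a / 2) rfl) 1 with hg
    have hm : (monomial m 1 : P k) = (∏ i ∈ E, X i) * g ^ 2 := by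
      have : (∏ i ∈ E, X i : P k) = monomial (∑ i ∈ E, Finsupp.single i 1) 1 := by
        simp only [X, monomial_sum_one]
      rw [this, hg, sq, monomial_mul, monomial_mul, one_mul, one_mul]
      congr 2
      ext i
      rw [Finsupp.add_apply, Finsupp.finsetSum_apply, Finsupp.add_apply, Finsupp.mapRange_apply]
      have : ∑ j ∈ E, (Finsupp.single j 1 : Fin k →₀ ℕ) i = if Odd (m i) then 1 else 0 := by
        simp [Finsupp.single_apply, hE]
      rw [this]
      split_ifs with h
      · rw [Nat.odd_iff] at h; omega
      · rw [Nat.odd_iff] at h; omega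
    have hphiE : phi k (∏ i ∈ E, X i) = 1 ∨ phi k (∏ i ∈ E, X i) = 0 := by
      have : (∏ i ∈ E, X i : P k) = monomial (∑ i ∈ E, Finsupp.single i 1) 1 := by
        simp only [X, monomial_sum_one]
      rw [this, phi_monomial]
      split_ifs with h
      · left
        have h0 : (∑ i ∈ E, Finsupp.single i 1 : Fin k →₀ ℕ).mapRange (fun a => a / 2) rfl = 0 := by
          ext i
          rw [Finsupp.mapRange_apply, Finsupp.finsetSum_apply]
          simp only [Finsupp.single_apply, Finset.sum_ite_eq', Finsupp.coe_zero, Pi.zero_apply]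
          split_ifs <;> rfl
        rw [h0]; rfl
      · right; rfl
    have hsq : ∀ (q : Polynomial (P k)) (b : ℕ),
        (q ^ 2).coeff b = if Even b then q.coeff (b / 2) ^ 2 else 0 := by
      intro q b
      rw [← Polynomial.map_frobenius_expand 2, Polynomial.coeff_map,
        Polynomial.coeff_expand two_pos]
      simp only [even_iff_two_dvd]
      split_ifs
      · rfl
      · exact map_zero _
    have hcoeff : phi k (Sq k j (monomial m 1))
        = phi k (∏ i ∈ E, X i) * (if Even j then Sq k (j / 2) g else 0) := by
      rw [hm]
      change phi k ((totalSq k (_ * g ^ 2)).coeff j) = _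
      rw [map_mul, map_pow, Polynomial.coeff_mul, map_sum,
        Finset.sum_eq_single_of_mem (0, j) (by simp)]
      · rw [hsq]
        split_ifs with h
        · rw [phi_mul_sq, phi_coeff_totalSq_prod, if_pos rfl]; rfl
        · simp
      · rintro ⟨a, b⟩ hab hne
        have ha : a ≠ 0 := by
          rintro rfl
          apply hne
          simpa using hab
        rw [hsq]
        split_ifs with h
        · rw [phi_mul_sq, phi_coeff_totalSq_prod, if_neg ha, zero_mul]
        · simp
    rw [hcoeff, hm, phi_mul_sq]
    rcases hphiE with h | h
    · rw [h, one_mul, one_mul]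
    · simp [h]

theorem hit_le_comap_phi (k : ℕ) : hit k ≤ (hit k).comap (phi k) := by
  refine hit_le fun i hi f => ?_
  rw [Submodule.mem_comap, phi_Sq]
  split_ifs with h
  · obtain ⟨j, rfl⟩ := h
    exact Sq_mem_hit (by omega) _
  · exact Submodule.zero_mem _

/-- Kameko's squaring operation `S̃q^0_* : 𝔽₂ ⊗_𝒜 P_k → 𝔽₂ ⊗_𝒜 P_k`, induced by `φ`; it maps
`(𝔽₂ ⊗_𝒜 P_k)_{2d+k}` to `(𝔽₂ ⊗_𝒜 P_k)_d`. -/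
noncomputable def kamekoSq (k : ℕ) : Module.End (ZMod 2) (Q k) :=
  (hit k).mapQ (hit k) (phi k) (hit_le_comap_phi k)

/-- `(S̃q^0_*)^{s-t}` restricts to an isomorphism of `GL_k`-modules
`(𝔽₂ ⊗_𝒜 P_k)_{k(2^s-1) + 2^s d} → (𝔽₂ ⊗_𝒜 P_k)_{k(2^t-1) + 2^t d}` (used for `t ≤ s`). -/
def IsKamekoIso (k t s d : ℕ) : Prop :=
  ∃ e : Representation.Equiv (degRep k (k * (2 ^ s - 1) + 2 ^ s * d))
      (degRep k (k * (2 ^ t - 1) + 2 ^ t * d)),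
    ∀ z : qDeg k (k * (2 ^ s - 1) + 2 ^ s * d), (e z : Q k) = (kamekoSq k ^ (s - t)) (z : Q k)

/-! ### The number `t(k, d)` -/

/-- The number `α(n)` of ones in the dyadic expansion of `n`. -/
def alpha (n : ℕ) : ℕ := (Nat.digits 2 n).count 1

/-- The greatest `u` such that `2^u` divides `n` (for `n > 0`). -/
def zeta (n : ℕ) : ℕ := padicValNat 2 n

/-- `t(k, d) = max {0, k - α(d + k) - ζ(d + k)}`. -/
def tBound (k d : ℕ) : ℤ := max 0 ((k : ℤ) - alpha (d + k) - zeta (d + k))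

end Kameko

/-!
The section `ψ y = x_1 ⋯ x_k y²` of `φ` makes `S̃q^0_*` surjective in every degree. In degree
`n = 2d + k` with `k ≤ α(d+k) + ζ(d+k)` it is also injective: a monomial with some even exponent is
`x^u · Sq^{|q|}(x^q)` with `x^u` a product of `r < k` distinct variables, and moving the square to
`x^u` by the Cartan formula can only produce products of `r` powers `x_j^{2^a}` of degree `r + |q|`,
which do not exist because `α(r + |q|) > r`; so every such monomial is hit. Hence `f ≡ ψ φ f`
modulo hits for every `f` of degree `n`, and `ψ` carries hits of degree `d` to hits.

Conversely put `N = 2^s (d + k)` with `k = s + α(d+k) + ζ(d+k)` and `s > 0`. Since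
`α(N - 1) + 1 = α(N) + ζ(N) = k`, the number `N - 1` is a sum of `k - 1` powers of two, so there is
a spike of degree `N - k = k(2^s - 1) + 2^s d` in `k - 1` of the variables. It is not hit, but `φ`
kills it. Thus `t(k,d)` is the exact bound for each `d`; it never exceeds `k - 2`, because
`α(n) + ζ(n) ≥ 2` for `n ≥ 2`, and at `d = 2^k - k + 1` it equals `k - 2`.
-/

namespace Kameko

open MvPolynomial

/-! ### Binary digit sums -/

theorem alpha_eq_sum_digits (n : ℕ) : alpha n = (Nat.digits 2 n).sum := by
  have count_one_eq_sum : ∀ l : List ℕ, (∀ a ∈ l, a < 2) → l.count 1 = l.sum := by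
    intro l hl
    induction l with
    | nil => rfl
    | cons a l ih =>
      obtain ⟨ha, hl⟩ := List.forall_mem_cons.1 hl
      rw [List.count_cons, List.sum_cons, ih hl]
      interval_cases a <;> simp [add_comm]
  exact count_one_eq_sum _ fun a ha => Nat.digits_lt_base one_lt_two ha

theorem padicValNat_factorial_add_alpha (n : ℕ) : padicValNat 2 n.factorial + alpha n = n := by
  have legendre := sub_one_mul_padicValNat_factorial (p := 2) n
  have := Nat.digit_sum_le 2 n
  rw [alpha_eq_sum_digits]
  omega

theorem alpha_le_self (n : ℕ) : alpha n ≤ n := by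
  have := padicValNat_factorial_add_alpha n
  omega

theorem alpha_add_le (m n : ℕ) : alpha (m + n) ≤ alpha m + alpha n := by
  have hle : padicValNat 2 m.factorial + padicValNat 2 n.factorial
      ≤ padicValNat 2 (m + n).factorial := by
    rw [← padicValNat.mul m.factorial_ne_zero n.factorial_ne_zero]
    exact (padicValNat_dvd_iff_le (Nat.factorial_ne_zero _)).1
      (pow_padicValNat_dvd.trans (Nat.factorial_mul_factorial_dvd_factorial_add m n))
  have hm := padicValNat_factorial_add_alpha m
  have hn := padicValNat_factorial_add_alpha n
  have hmn := padicValNat_factorial_add_alpha (m + n)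
  omega

theorem alpha_add_one (n : ℕ) : alpha n + 1 = alpha (n + 1) + zeta (n + 1) := by
  have hn := padicValNat_factorial_add_alpha n
  have hn1 := padicValNat_factorial_add_alpha (n + 1)
  rw [Nat.factorial_succ, padicValNat.mul (by omega) n.factorial_ne_zero] at hn1
  rw [zeta]
  omega

theorem alpha_two_pow_mul (s n : ℕ) : alpha (2 ^ s * n) = alpha n := by
  rcases n.eq_zero_or_pos with rfl | hn
  · rw [mul_zero]
  · rw [alpha, Nat.digits_base_pow_mul one_lt_two hn, List.count_append, List.count_replicate]
    simp [alpha]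

theorem alpha_two_pow (s : ℕ) : alpha (2 ^ s) = 1 := by
  rw [← mul_one (2 ^ s), alpha_two_pow_mul]
  simp [alpha]

theorem lt_alpha_add {k r q : ℕ} (hr : r < k)
    (hk : k < alpha (r + 2 * q + k) + zeta (r + 2 * q + k)) : r < alpha (r + q) := by
  have hpred : r + 2 * q + (k - 1) = 2 ^ 1 * (r + q) + (k - 1 - r) := by omega
  have halpha := alpha_add_one (r + 2 * q + (k - 1))
  have hadd := alpha_add_le (2 ^ 1 * (r + q)) (k - 1 - r)
  have hself := alpha_le_self (k - 1 - r)
  rw [add_assoc _ (k - 1), Nat.sub_add_cancel (by omega)] at halpha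
  rw [← hpred, alpha_two_pow_mul] at hadd
  omega

theorem alpha_two_mul_add_one (n : ℕ) : alpha (2 * n + 1) = alpha n + 1 := by
  have hzeta : zeta (2 * n + 1) = 0 := padicValNat.eq_zero_of_not_dvd (by omega)
  rw [← add_zero (alpha (2 * n + 1)), ← hzeta, ← alpha_add_one, ← pow_one 2, alpha_two_pow_mul]

theorem alpha_sum_two_pow_le {ι : Type*} (E : Finset ι) (b : ι → ℕ) :
    alpha (∑ i ∈ E, 2 ^ b i) ≤ E.card := by
  have h := Finset.le_sum_of_subadditive alpha (by simp [alpha]) alpha_add_le E fun i => 2 ^ b i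
  simpa only [alpha_two_pow, Finset.card_eq_sum_ones] using h

theorem zeta_two_pow_mul (s : ℕ) {n : ℕ} (hn : n ≠ 0) : zeta (2 ^ s * n) = s + zeta n := by
  rw [zeta, padicValNat.mul (by positivity) hn, padicValNat.prime_pow, zeta]

theorem two_le_alpha_add_zeta {n : ℕ} (hn : 2 ≤ n) : 2 ≤ alpha n + zeta n := by
  obtain ⟨m, rfl⟩ : ∃ m, n = m + 1 := ⟨n - 1, by omega⟩
  have hpos : 0 < alpha m := by
    have := padicValNat_factorial_add_alpha m
    have := padicValNat_factorial_lt_of_ne_zero 2 (n := m) (by omega)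
    omega
  rw [← alpha_add_one]
  omega

theorem length_bitIndices (n : ℕ) : n.bitIndices.length = alpha n := by
  induction n using Nat.strong_induction_on with
  | _ n ih =>
    obtain ⟨m, rfl | rfl⟩ := n.even_or_odd'
    · rcases m.eq_zero_or_pos with rfl | hm
      · simp [alpha]
      · rw [Nat.bitIndices_two_mul, List.length_map, ih m (by omega), ← alpha_two_pow_mul 1,
          pow_one]
    · rw [Nat.bitIndices_two_mul_add_one, alpha_two_mul_add_one, List.length_cons, List.length_map,
        ih m (by omega)]

theorem exists_sum_two_pow_eq (n : ℕ) : ∃ b : Fin (alpha n) → ℕ, ∑ i, 2 ^ b i = n := by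
  rw [← length_bitIndices]
  refine ⟨n.bitIndices.get, ?_⟩
  conv_rhs => rw [← Nat.sum_map_two_pow_bitIndices n]
  exact Fin.sum_univ_fun_getElem n.bitIndices (2 ^ ·)

theorem tBound_le_natCast_iff {k d t : ℕ} :
    tBound k d ≤ t ↔ k ≤ alpha (d + k) + zeta (d + k) + t := by
  rw [tBound]
  omega

theorem tBound_le_sub_two {k : ℕ} (hk : 2 ≤ k) (d : ℕ) : tBound k d ≤ (k - 2 : ℕ) := by
  have := two_le_alpha_add_zeta (n := d + k) (by omega)
  rw [tBound_le_natCast_iff]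
  omega

theorem tBound_two_pow_sub_add_one {k : ℕ} (hk : 2 ≤ k) :
    tBound k (2 ^ k - k + 1) = (k : ℤ) - 2 := by
  have hd : 2 ^ k - k + 1 + k = 2 ^ k + 1 := by
    have : k < 2 ^ k := Nat.lt_two_pow_self
    omega
  have hodd : ¬ 2 ∣ 2 ^ k + 1 := by
    rw [← even_iff_two_dvd]
    exact Nat.not_even_iff_odd.2 (Nat.even_pow.2 ⟨even_two, by omega⟩).add_one
  have hzeta : zeta (2 ^ k + 1) = 0 := padicValNat.eq_zero_of_not_dvd hodd
  have halpha := alpha_add_one (2 ^ k)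
  rw [alpha_two_pow, hzeta] at halpha
  rw [tBound, hd, hzeta]
  omega

/-! ### Polynomials and exponent vectors -/

theorem coeff_prod_eq_sum_finsuppAntidiag {R ι : Type*} [CommSemiring R] [DecidableEq ι]
    (f : ι → Polynomial R) (s : Finset ι) (n : ℕ) :
    (∏ j ∈ s, f j).coeff n = ∑ p ∈ s.finsuppAntidiag n, ∏ j ∈ s, (f j).coeff (p j) := by
  simp only [← Polynomial.coeff_coe, ← PowerSeries.coeff_prod]
  exact congrArg _ (map_prod (Polynomial.coeToPowerSeries.ringHom (R := R)) f s)

theorem homogeneousSubmodule_le {σ R : Type*} [CommSemiring R] {n : ℕ}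
    {W : Submodule R (MvPolynomial σ R)}
    (h : ∀ m : σ →₀ ℕ, m.degree = n → monomial m 1 ∈ W) : homogeneousSubmodule σ R n ≤ W := by
  intro f hf
  rw [f.as_sum]
  refine W.sum_mem fun m hm => ?_
  rw [← mul_one (coeff m f), ← smul_eq_mul, ← smul_monomial]
  exact W.smul_mem _ (h m (hf.degree_eq_sum_deg_support hm).symm)

theorem eq_top_of_monomial_mem {σ R : Type*} [CommSemiring R] {W : Submodule R (MvPolynomial σ R)}
    (h : ∀ m : σ →₀ ℕ, monomial m 1 ∈ W) : W = ⊤ := by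
  rw [eq_top_iff, ← (basisMonomials σ R).span_eq, Submodule.span_le]
  rintro _ ⟨m, rfl⟩
  simpa using h m

theorem exists_eq_add_two_nsmul {σ : Type*} (m : σ →₀ ℕ) :
    ∃ u q : σ →₀ ℕ, (∀ j, u j ≤ 1) ∧ m = u + 2 • q := by
  refine ⟨m.mapRange (· % 2) rfl, m.mapRange (· / 2) rfl, fun j => ?_, ?_⟩
  · exact Nat.lt_succ_iff.1 (Nat.mod_lt _ two_pos)
  · ext j
    exact (Nat.mod_add_div (m j) 2).symm

theorem degree_lt_card_of_le_one {σ : Type*} [Fintype σ] {u : σ →₀ ℕ} (hle : ∀ j, u j ≤ 1)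
    (hne : ∃ j, u j ≠ 1) : u.degree < Fintype.card σ := by
  obtain ⟨j, hj⟩ := hne
  have hlt : ∑ i, u i < ∑ _i : σ, 1 :=
    Finset.sum_lt_sum (fun i _ => hle i) ⟨j, Finset.mem_univ j, by have := hle j; omega⟩
  simpa [Finsupp.degree_eq_sum] using hlt

theorem monomial_add_two_nsmul {σ R : Type*} [CommSemiring R] (u q : σ →₀ ℕ) :
    (monomial (u + 2 • q) 1 : MvPolynomial σ R) = monomial u 1 * monomial q 1 ^ 2 := by
  rw [monomial_pow, monomial_mul, one_pow, one_mul]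

theorem monomial_eq_prod_X {σ R : Type*} [Fintype σ] [CommSemiring R] {u : σ →₀ ℕ}
    (hu : ∀ j, u j = 1) : (monomial u 1 : MvPolynomial σ R) = ∏ j, X j := by
  rw [monomial_eq, C_1, one_mul, Finsupp.prod_fintype _ _ fun _ => pow_zero _]
  simp only [hu, pow_one]

/-- `x^m` is a product of distinct variables raised to powers of two, a shape of monomial that the
Steenrod squares preserve. -/
def HasTwoPowExponents {σ : Type*} (m : σ →₀ ℕ) : Prop :=
  ∀ j ∈ m.support, ∃ a, m j = 2 ^ a

theorem HasTwoPowExponents.alpha_degree_le {σ : Type*} {m : σ →₀ ℕ}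
    (hm : HasTwoPowExponents m) : alpha m.degree ≤ m.support.card := by
  choose! b hb using hm
  rw [Finsupp.degree_apply, Finset.sum_congr rfl hb]
  exact alpha_sum_two_pow_le _ b

theorem eq_zero_or_eq_of_odd_choose_two_pow {a b : ℕ} (h : ¬ 2 ∣ (2 ^ a).choose b) :
    b = 0 ∨ b = 2 ^ a := by
  by_contra! hb
  exact h (Nat.prime_two.dvd_choose_pow hb.1 hb.2)

theorem le_of_odd_choose {a b : ℕ} (h : ¬ 2 ∣ a.choose b) : b ≤ a := by
  by_contra! hlt
  exact h (Nat.choose_eq_zero_of_lt hlt ▸ dvd_zero 2)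

theorem support_add_eq_left_of_le {σ : Type*} {m p : σ →₀ ℕ} (h : p ≤ m) :
    (m + p).support = m.support := by
  ext j
  have hj := h j
  simp only [Finsupp.mem_support_iff, Finsupp.add_apply]
  omega

theorem HasTwoPowExponents.add {σ : Type*} {m p : σ →₀ ℕ}
    (hm : HasTwoPowExponents m) (hp : ∀ j, ¬ 2 ∣ (m j).choose (p j)) :
    HasTwoPowExponents (m + p) := by
  intro j hj
  obtain ⟨a, ha⟩ := hm j (support_add_eq_left_of_le (fun i => le_of_odd_choose (hp i)) ▸ hj)
  have hpj := hp j
  rw [ha] at hpj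
  rw [Finsupp.add_apply, ha]
  rcases eq_zero_or_eq_of_odd_choose_two_pow hpj with h | h
  · exact ⟨a, by rw [h, add_zero]⟩
  · exact ⟨a + 1, by rw [h, pow_succ, mul_two]⟩

/-! ### Steenrod squares of monomials -/

variable {k : ℕ}

theorem hit_le_of_monomial {W : Submodule (ZMod 2) (P k)}
    (h : ∀ i, 1 ≤ i → ∀ m, Sq k i (monomial m 1) ∈ W) : hit k ≤ W :=
  hit_le fun i hi f => by
    have htop : W.comap (Sq k i) = ⊤ := eq_top_of_monomial_mem (h i hi)
    exact htop.ge (Submodule.mem_top (x := f))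

theorem Sq_mul (n : ℕ) (f g : P k) :
    Sq k n (f * g) = ∑ p ∈ Finset.HasAntidiagonal.antidiagonal n, Sq k p.1 f * Sq k p.2 g := by
  change (totalSq k (f * g)).coeff n = _
  rw [map_mul, Polynomial.coeff_mul]
  rfl

theorem Sq_X_pow (i : ℕ) (j : Fin k) (a : ℕ) :
    Sq k i (X j ^ a) = C (a.choose i : ZMod 2) * X j ^ (a + i) := by
  have hX : totalSq k (X j)
      = Polynomial.C (X j) * (1 + Polynomial.X).comp (Polynomial.C (X j) * .X) := by
    rw [totalSq, aeval_X, Polynomial.add_comp, Polynomial.one_comp, Polynomial.X_comp, sq,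
      Polynomial.C_mul]
    ring
  change (totalSq k (X j ^ a)).coeff i = _
  rw [map_pow, hX, mul_pow, ← Polynomial.C_pow, ← Polynomial.pow_comp, Polynomial.coeff_C_mul,
    Polynomial.comp_C_mul_X_coeff, Polynomial.coeff_one_add_X_pow, map_natCast]
  ring

theorem Sq_monomial (i : ℕ) (m : Fin k →₀ ℕ) :
    Sq k i (monomial m 1) = ∑ p ∈ Finset.univ.finsuppAntidiag i,
      monomial (m + p) (∏ j, ((m j).choose (p j) : ZMod 2)) := by
  have hmonomial (e : Fin k →₀ ℕ) (c : ZMod 2) : (monomial e c : P k) = C c * ∏ j, X j ^ e j := by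
    rw [monomial_eq, Finsupp.prod_fintype _ _ fun _ => pow_zero _]
  change (totalSq k (monomial m 1)).coeff i = _
  rw [hmonomial, C_1, one_mul, map_prod, coeff_prod_eq_sum_finsuppAntidiag]
  refine Finset.sum_congr rfl fun p _ => ?_
  rw [hmonomial, map_prod, ← Finset.prod_mul_distrib]
  exact Finset.prod_congr rfl fun j _ => Sq_X_pow (p j) j (m j)

theorem Sq_zero (f : P k) : Sq k 0 f = f := by
  have h : (Polynomial.constantCoeff (R := P k)).comp (totalSq k : P k →+* Polynomial (P k))
      = RingHom.id (P k) := by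
    refine MvPolynomial.ringHom_ext (fun c => ?_) fun j => ?_
    · simp [totalSq, Polynomial.algebraMap_apply]
    · simp [totalSq]
  exact RingHom.congr_fun h f

theorem Sq_monomial_mem {i : ℕ} {m : Fin k →₀ ℕ} {W : Submodule (ZMod 2) (P k)}
    (h : ∀ p : Fin k →₀ ℕ, p.degree = i → (∀ j, ¬ 2 ∣ (m j).choose (p j)) →
      monomial (m + p) 1 ∈ W) : Sq k i (monomial m 1) ∈ W := by
  rw [Sq_monomial]
  refine W.sum_mem fun p hp => ?_
  rw [monomial_eq_smul]
  by_cases hc : ∀ j, ¬ 2 ∣ (m j).choose (p j)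
  · refine W.smul_mem _ (h p ?_ hc)
    rw [Finsupp.degree_eq_sum]
    exact (Finset.mem_finsuppAntidiag.1 hp).1
  · push Not at hc
    obtain ⟨j, hj⟩ := hc
    rw [Finset.prod_eq_zero (Finset.mem_univ j) ((ZMod.natCast_eq_zero_iff _ _).2 hj), zero_smul]
    exact W.zero_mem

theorem Sq_degree_monomial (m : Fin k →₀ ℕ) :
    Sq k m.degree (monomial m 1) = monomial m 1 ^ 2 := by
  have hm : m ∈ Finset.univ.finsuppAntidiag m.degree := by
    simp [Finsupp.degree_eq_sum]
  rw [Sq_monomial, Finset.sum_eq_single_of_mem m hm]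
  · simp [sq, monomial_mul]
  · intro p hp hne
    obtain ⟨j, hj⟩ : ∃ j, m j < p j := by
      by_contra! hle
      rw [Finset.mem_finsuppAntidiag, Finsupp.degree_eq_sum] at hp
      exact hne (Finsupp.ext fun j =>
        (Finset.sum_eq_sum_iff_of_le fun j _ => hle j).1 hp.1 j (Finset.mem_univ j))
    rw [Finset.prod_eq_zero (Finset.mem_univ j)
      (by rw [Nat.choose_eq_zero_of_lt hj, Nat.cast_zero]), map_zero]

theorem isHomogeneous_Sq {n : ℕ} (i : ℕ) {f : P k} (hf : f.IsHomogeneous n) :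
    (Sq k i f).IsHomogeneous (n + i) := by
  have h : homogeneousSubmodule (Fin k) (ZMod 2) n
      ≤ (homogeneousSubmodule (Fin k) (ZMod 2) (n + i)).comap (Sq k i) :=
    homogeneousSubmodule_le fun m hm => by
      rw [Submodule.mem_comap]
      exact Sq_monomial_mem fun p hp _ => isHomogeneous_monomial 1 (by rw [map_add, hm, hp])
  exact h hf

/-! ### Hit monomials -/

-- The Cartan formula moves `Sq^d` from `v` to `x^m`; once all squares act on the left factor, its
-- degree is `m.degree + d`, which is a sum of `m.support.card` powers of two.
theorem HasTwoPowExponents.monomial_mul_Sq_mem_hit {m : Fin k →₀ ℕ} (hm : HasTwoPowExponents m)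
    {d : ℕ} (hlt : m.support.card < alpha (m.degree + d)) (v : P k) :
    monomial m 1 * Sq k d v ∈ hit k := by
  induction d using Nat.strong_induction_on generalizing m with
  | _ d ih =>
    rcases d with _ | d
    · exact absurd hm.alpha_degree_le hlt.not_ge
    have cartan := Sq_mul (d + 1) (monomial m 1) v
    rw [Finset.Nat.sum_antidiagonal_succ, Sq_zero, ← sub_eq_iff_eq_add] at cartan
    rw [← cartan]
    refine (hit k).sub_mem (Sq_mem_hit (by omega) _) ((hit k).sum_mem fun ⟨i, l⟩ hil => ?_)
    rw [Finset.HasAntidiagonal.mem_antidiagonal] at hil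
    refine Sq_monomial_mem (W := (hit k).comap (LinearMap.mulRight (ZMod 2) (Sq k l v)))
      fun p hp hodd => ih l (by omega) (hm.add hodd) ?_
    rw [support_add_eq_left_of_le fun j => le_of_odd_choose (hodd j), map_add, hp, add_assoc]
    convert hlt using 3
    omega

theorem monomial_mem_hit {m : Fin k →₀ ℕ} (hm : ∃ j, ¬ Odd (m j))
    (hk : k < alpha (m.degree + k) + zeta (m.degree + k)) : (monomial m 1 : P k) ∈ hit k := by
  obtain ⟨u, q, hu, rfl⟩ := exists_eq_add_two_nsmul m
  have hne : ∃ j, u j ≠ 1 := by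
    obtain ⟨j, hj⟩ := hm
    refine ⟨j, fun h => hj ⟨q j, ?_⟩⟩
    simp [h, add_comm]
  have hsupport : ∀ j ∈ u.support, u j = 2 ^ 0 := fun j hj => by
    have := hu j
    have := Finsupp.mem_support_iff.1 hj
    omega
  have hcard : u.support.card = u.degree := by
    rw [Finsupp.degree_apply, Finset.sum_congr rfl hsupport, pow_zero, Finset.card_eq_sum_ones]
  have hfactor : (monomial (u + 2 • q) 1 : P k)
      = monomial u 1 * Sq k q.degree (monomial q 1) := by
    rw [Sq_degree_monomial, monomial_add_two_nsmul]
  rw [hfactor]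
  refine HasTwoPowExponents.monomial_mul_Sq_mem_hit (fun j hj => ⟨0, hsupport j hj⟩) ?_ _
  rw [map_add, map_nsmul, smul_eq_mul] at hk
  rw [hcard]
  exact lt_alpha_add (by simpa using degree_lt_card_of_le_one hu hne) hk

/-! ### Kameko's up operation -/

variable (k) in
/-- Kameko's up operation `y ↦ x_1 ⋯ x_k y²`, a linear section of `phi`. -/
noncomputable def psi : P k →ₗ[ZMod 2] P k where
  toFun y := (∏ j, X j) * y ^ 2
  map_add' y z := by rw [add_pow_char, mul_add]
  map_smul' c y := by
    rw [smul_pow, ZMod.pow_card, mul_smul_comm, RingHom.id_apply]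

theorem psi_apply (y : P k) : psi k y = (∏ j, X j) * y ^ 2 := rfl

theorem phi_prod_X : phi k (∏ j, X j) = 1 := by
  obtain ⟨ones, hones⟩ : ∃ ones : Fin k →₀ ℕ, ∀ j, ones j = 1 :=
    ⟨Finsupp.equivFunOnFinite.symm 1, by simp⟩
  have hhalf : ones.mapRange (· / 2) rfl = 0 := by
    ext j
    simp [hones]
  rw [← monomial_eq_prod_X hones, phi_monomial, if_pos fun j => hones j ▸ odd_one, hhalf,
    monomial_zero', C_1]

theorem phi_psi (y : P k) : phi k (psi k y) = y := by
  rw [psi_apply, phi_mul_sq, phi_prod_X, one_mul]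

theorem isHomogeneous_psi {d : ℕ} {y : P k} (hy : y.IsHomogeneous d) :
    (psi k y).IsHomogeneous (2 * d + k) := by
  have hprod : (∏ j : Fin k, X j : P k).IsHomogeneous k := by
    simpa using IsHomogeneous.prod (Finset.univ : Finset (Fin k)) X (fun _ => 1)
      fun j _ => isHomogeneous_X (ZMod 2) j
  rw [psi_apply, add_comm, mul_comm 2]
  exact hprod.mul (hy.pow 2)

theorem exists_monomial_eq_psi {m : Fin k →₀ ℕ} (hm : ∀ j, Odd (m j)) :
    ∃ q : Fin k →₀ ℕ, 2 * q.degree + k = m.degree ∧ monomial m 1 = psi k (monomial q 1) := by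
  obtain ⟨u, q, hu, rfl⟩ := exists_eq_add_two_nsmul m
  have hu_one : ∀ j, u j = 1 := fun j => by
    have hle := hu j
    have hodd := Nat.odd_iff.1 (hm j)
    simp only [Finsupp.add_apply, Finsupp.smul_apply, smul_eq_mul] at hodd
    omega
  refine ⟨q, ?_, by rw [monomial_add_two_nsmul, monomial_eq_prod_X hu_one, psi_apply]⟩
  simp [Finsupp.degree_eq_sum, hu_one, Finset.sum_add_distrib, Finset.mul_sum, add_comm]

theorem phi_monomial_eq_zero {m : Fin k →₀ ℕ} (hm : ∃ j, ¬ Odd (m j)) :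
    phi k (monomial m 1) = 0 := by
  rw [phi_monomial, if_neg (not_forall.2 hm)]

theorem isHomogeneous_phi {d : ℕ} {f : P k} (hf : f.IsHomogeneous (2 * d + k)) :
    (phi k f).IsHomogeneous d := by
  have h : homogeneousSubmodule (Fin k) (ZMod 2) (2 * d + k)
      ≤ (homogeneousSubmodule (Fin k) (ZMod 2) d).comap (phi k) :=
    homogeneousSubmodule_le fun m hm => by
      rw [Submodule.mem_comap]
      by_cases hodd : ∀ j, Odd (m j)
      · obtain ⟨q, hq, hmq⟩ := exists_monomial_eq_psi hodd
        rw [hmq, phi_psi]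
        exact isHomogeneous_monomial 1 (by omega)
      · rw [phi_monomial_eq_zero (not_forall.1 hodd)]
        exact Submodule.zero_mem _
  exact h hf

theorem sub_psi_phi_mem_hit {n : ℕ} (hn : k < alpha (n + k) + zeta (n + k)) {f : P k}
    (hf : f.IsHomogeneous n) : f - psi k (phi k f) ∈ hit k := by
  have h : homogeneousSubmodule (Fin k) (ZMod 2) n
      ≤ (hit k).comap (LinearMap.id - psi k ∘ₗ phi k) :=
    homogeneousSubmodule_le fun m hm => by
      change monomial m 1 - psi k (phi k (monomial m 1)) ∈ hit k
      by_cases hodd : ∀ j, Odd (m j)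
      · obtain ⟨q, -, hmq⟩ := exists_monomial_eq_psi hodd
        rw [hmq, phi_psi, sub_self]
        exact (hit k).zero_mem
      · rw [phi_monomial_eq_zero (not_forall.1 hodd), map_zero, sub_zero]
        exact monomial_mem_hit (not_forall.1 hodd) (hm ▸ hn)
  exact h hf

theorem mem_hit_of_phi_eq_zero {n : ℕ} (hn : k < alpha (n + k) + zeta (n + k)) {f : P k}
    (hf : f.IsHomogeneous n) (hphi : phi k f = 0) : f ∈ hit k := by
  simpa [hphi] using sub_psi_phi_mem_hit hn hf

theorem psi_Sq_mem_hit {i d : ℕ} (hi : 1 ≤ i)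
    (hd : k < alpha (2 * (d + i) + k + k) + zeta (2 * (d + i) + k + k)) {g : P k}
    (hg : g.IsHomogeneous d) : psi k (Sq k i g) ∈ hit k := by
  have hdiff : Sq k (2 * i) (psi k g) - psi k (Sq k i g) ∈ hit k := by
    refine mem_hit_of_phi_eq_zero hd ?_ ?_
    · have hdeg : 2 * d + k + 2 * i = 2 * (d + i) + k := by ring
      exact (hdeg ▸ isHomogeneous_Sq (2 * i) (isHomogeneous_psi hg)).sub
        (isHomogeneous_psi (isHomogeneous_Sq i hg))
    · rw [map_sub, phi_psi, phi_Sq, if_pos (even_two_mul i), Nat.mul_div_cancel_left i two_pos,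
        phi_psi, sub_self]
  simpa using (hit k).sub_mem (Sq_mem_hit (i := 2 * i) (by omega) (psi k g)) hdiff

theorem psi_mem_hit {d : ℕ} (hd : k < alpha (2 * d + k + k) + zeta (2 * d + k + k)) {f : P k}
    (hf : f.IsHomogeneous d) (hmem : f ∈ hit k) : psi k f ∈ hit k := by
  have hle : hit k ≤ (hit k).comap (psi k ∘ₗ homogeneousComponent d) :=
    hit_le_of_monomial fun i hi m => by
      have hm : (monomial m 1 : P k).IsHomogeneous m.degree := isHomogeneous_monomial 1 rfl
      rw [Submodule.mem_comap, LinearMap.comp_apply,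
        homogeneousComponent_of_mem (isHomogeneous_Sq i hm)]
      split_ifs with hdeg
      · exact psi_Sq_mem_hit hi (hdeg ▸ hd) hm
      · rw [map_zero]
        exact (hit k).zero_mem
  have hcomponent := hle hmem
  rwa [Submodule.mem_comap, LinearMap.comp_apply, homogeneousComponent_of_mem hf, if_pos rfl]
    at hcomponent

theorem mem_hit_of_phi_mem_hit {d : ℕ}
    (hd : k < alpha (2 * d + k + k) + zeta (2 * d + k + k)) {f : P k}
    (hf : f.IsHomogeneous (2 * d + k)) (hphi : phi k f ∈ hit k) : f ∈ hit k := by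
  have h := (hit k).add_mem (sub_psi_phi_mem_hit hd hf) (psi_mem_hit hd (isHomogeneous_phi hf) hphi)
  rwa [sub_add_cancel] at h

theorem kamekoSq_mkQ (f : P k) : kamekoSq k ((hit k).mkQ f) = (hit k).mkQ (phi k f) := rfl

theorem mapsTo_kamekoSq (d : ℕ) : Set.MapsTo (kamekoSq k) (qDeg k (2 * d + k)) (qDeg k d) := by
  rintro _ ⟨f, hf, rfl⟩
  exact ⟨phi k f, isHomogeneous_phi hf, rfl⟩

theorem surjOn_kamekoSq (d : ℕ) : Set.SurjOn (kamekoSq k) (qDeg k (2 * d + k)) (qDeg k d) := by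
  rintro _ ⟨f, hf, rfl⟩
  exact ⟨(hit k).mkQ (psi k f), ⟨psi k f, isHomogeneous_psi hf, rfl⟩, by
    rw [kamekoSq_mkQ, phi_psi]⟩

theorem injOn_kamekoSq {d : ℕ} (hd : d + k ≠ 0) (hk : k ≤ alpha (d + k) + zeta (d + k)) :
    Set.InjOn (kamekoSq k) (qDeg k (2 * d + k)) := by
  have hdouble : 2 * d + k + k = 2 ^ 1 * (d + k) := by ring
  have hlt : k < alpha (2 * d + k + k) + zeta (2 * d + k + k) := by
    rw [hdouble, alpha_two_pow_mul, zeta_two_pow_mul 1 hd]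
    omega
  intro x hx y hy hxy
  obtain ⟨f, hf, hfe⟩ := (qDeg k (2 * d + k)).sub_mem hx hy
  have hphi : kamekoSq k (x - y) = 0 := by rw [map_sub, hxy, sub_self]
  rw [← sub_eq_zero, ← hfe]
  rw [← hfe, kamekoSq_mkQ] at hphi
  rw [Submodule.mkQ_apply, Submodule.Quotient.mk_eq_zero] at hphi ⊢
  exact mem_hit_of_phi_mem_hit hlt hf hphi

/-- The degree `k(2^s - 1) + 2^s d`, obtained from `d` by iterating `n ↦ 2n + k` exactly `s`
times. -/
def kamekoDegree (k s d : ℕ) : ℕ := k * (2 ^ s - 1) + 2 ^ s * d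

theorem kamekoDegree_add (k s d : ℕ) : kamekoDegree k s d + k = 2 ^ s * (d + k) := by
  obtain ⟨c, hc⟩ : ∃ c, 2 ^ s = c + 1 := Nat.exists_eq_add_one.2 (by positivity)
  rw [kamekoDegree, hc, Nat.add_sub_cancel]
  ring

theorem kamekoDegree_succ (k s d : ℕ) :
    kamekoDegree k (s + 1) d = 2 * kamekoDegree k s d + k := by
  have hs := kamekoDegree_add k s d
  have hs' := kamekoDegree_add k (s + 1) d
  rw [pow_succ', mul_assoc] at hs'
  omega

theorem mapsTo_kamekoSq_pow {t s : ℕ} (hts : t ≤ s) (d : ℕ) :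
    Set.MapsTo (kamekoSq k ^ (s - t)) (qDeg k (kamekoDegree k s d))
      (qDeg k (kamekoDegree k t d)) := by
  induction s, hts using Nat.le_induction with
  | base =>
    rw [Nat.sub_self, pow_zero]
    exact Set.mapsTo_id _
  | succ s hs ih =>
    rw [Nat.succ_sub hs, pow_succ, Module.End.coe_mul, kamekoDegree_succ]
    exact ih.comp (mapsTo_kamekoSq _)

theorem surjOn_kamekoSq_pow {t s : ℕ} (hts : t ≤ s) (d : ℕ) :
    Set.SurjOn (kamekoSq k ^ (s - t)) (qDeg k (kamekoDegree k s d))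
      (qDeg k (kamekoDegree k t d)) := by
  induction s, hts using Nat.le_induction with
  | base =>
    rw [Nat.sub_self, pow_zero]
    exact Set.surjOn_id _
  | succ s hs ih =>
    rw [Nat.succ_sub hs, pow_succ, Module.End.coe_mul, kamekoDegree_succ]
    exact ih.comp (surjOn_kamekoSq _)

theorem injOn_kamekoSq_pow {t s d : ℕ} (hd : d + k ≠ 0) (ht : tBound k d ≤ t) (hts : t ≤ s) :
    Set.InjOn (kamekoSq k ^ (s - t)) (qDeg k (kamekoDegree k s d)) := by
  induction s, hts using Nat.le_induction with
  | base =>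
    rw [Nat.sub_self, pow_zero]
    exact Set.injOn_id _
  | succ s hs ih =>
    rw [Nat.succ_sub hs, pow_succ, Module.End.coe_mul, kamekoDegree_succ]
    refine ih.comp (injOn_kamekoSq ?_ ?_) (mapsTo_kamekoSq _)
    · rw [kamekoDegree_add]
      positivity
    · rw [kamekoDegree_add, alpha_two_pow_mul, zeta_two_pow_mul s hd]
      have := tBound_le_natCast_iff.1 ht
      omega

/-! ### Equivariance -/

theorem phi_eq_zero_of_isHomogeneous {n : ℕ} {f : P k} (hf : f.IsHomogeneous n) (hn : n < k) :
    phi k f = 0 := by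
  have h : homogeneousSubmodule (Fin k) (ZMod 2) n ≤ LinearMap.ker (phi k) :=
    homogeneousSubmodule_le fun m hm => by
      refine phi_monomial_eq_zero ?_
      by_contra! hodd
      obtain ⟨q, hq, -⟩ := exists_monomial_eq_psi hodd
      omega
  exact h hf

variable (k) in
/-- The linear form `∑ i, v i • x_i` with coefficient vector `v`; linear substitutions send the
variables to such forms. -/
noncomputable def linearForm : (Fin k → ZMod 2) →ₗ[ZMod 2] P k :=
  Fintype.linearCombination (ZMod 2) X

theorem linearForm_basisFun (j : Fin k) :
    linearForm k (Pi.basisFun (ZMod 2) (Fin k) j) = X j := by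
  rw [Pi.basisFun_apply, linearForm, Fintype.linearCombination_apply_single, one_smul]

theorem isHomogeneous_linearForm (v : Fin k → ZMod 2) : (linearForm k v).IsHomogeneous 1 :=
  IsHomogeneous.sum _ _ _ fun i _ => by
    rw [smul_eq_C_mul]
    exact isHomogeneous_C_mul_X _ _

theorem subst_X_eq_linearForm (g : GLk k) (j : Fin k) :
    subst k g (X j) = linearForm k fun i => (g : Matrix (Fin k) (Fin k) (ZMod 2)) i j := by
  simp [subst_X, linearForm, Fintype.linearCombination_apply, smul_eq_C_mul]

theorem isHomogeneous_subst {n : ℕ} (g : GLk k) {f : P k} (hf : f.IsHomogeneous n) :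
    (subst k g f).IsHomogeneous n := by
  have h := hf.aeval (fun j => subst k g (X j)) (n := 1) fun j => by
    rw [subst_X_eq_linearForm]
    exact isHomogeneous_linearForm _
  rw [one_mul] at h
  rwa [show subst k g = aeval fun j => subst k g (X j) from algHom_ext (by simp)]

theorem phi_prod_linearForm_eq_zero {v : Fin k → Fin k → ZMod 2} {i j : Fin k} (hv : v i = v j)
    (hij : i ≠ j) : phi k (∏ l, linearForm k (v l)) = 0 := by
  have hj : j ∈ Finset.univ.erase i := Finset.mem_erase.2 ⟨hij.symm, Finset.mem_univ j⟩
  have hhom := IsHomogeneous.prod ((Finset.univ.erase i).erase j) (fun l => linearForm k (v l))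
    (fun _ => 1) fun l _ => isHomogeneous_linearForm (v l)
  have hcard : ∑ _l ∈ (Finset.univ.erase i).erase j, 1 < k := by
    have := Finset.card_pos.2 ⟨j, hj⟩
    rw [← Finset.card_eq_sum_ones, Finset.card_erase_of_mem hj]
    rw [Finset.card_erase_of_mem (Finset.mem_univ i), Finset.card_fin] at this ⊢
    omega
  rw [← Finset.prod_erase_mul _ _ (Finset.mem_univ i), ← Finset.prod_erase_mul _ _ hj, hv,
    mul_assoc, ← sq, phi_mul_sq, phi_eq_zero_of_isHomogeneous hhom hcard, zero_mul]

variable (k) in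
/-- `φ` of a product of `k` linear forms, as an alternating map of their coefficient vectors, hence
a multiple of the determinant. -/
noncomputable def phiProdLinearForm : (Fin k → ZMod 2) [⋀^Fin k]→ₗ[ZMod 2] P k where
  __ := (phi k).compMultilinearMap
    ((MultilinearMap.mkPiAlgebra (ZMod 2) (Fin k) (P k)).compLinearMap fun _ => linearForm k)
  map_eq_zero_of_eq' _ _ _ := phi_prod_linearForm_eq_zero

theorem phiProdLinearForm_apply (v : Fin k → Fin k → ZMod 2) :
    phiProdLinearForm k v = phi k (∏ j, linearForm k (v j)) := rfl

theorem phiProdLinearForm_eq_det (v : Fin k → Fin k → ZMod 2) :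
    phiProdLinearForm k v = C (Matrix.of v).det := by
  have h : phiProdLinearForm k
      = (Algebra.linearMap (ZMod 2) (P k)).compAlternatingMap Matrix.detRowAlternating := by
    refine (Pi.basisFun (ZMod 2) (Fin k)).ext_alternating fun σ hσ => ?_
    obtain ⟨σ, rfl⟩ : ∃ τ : Equiv.Perm (Fin k), τ = σ :=
      ⟨.ofBijective σ (Finite.injective_iff_bijective.1 hσ), rfl⟩
    have hperm (f : (Fin k → ZMod 2) [⋀^Fin k]→ₗ[ZMod 2] P k) := f.map_perm (Pi.basisFun _ _) σ
    simp only [Function.comp_def] at hperm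
    rw [hperm, hperm]
    congr 1
    have hone : Matrix.of (fun j => Pi.basisFun (ZMod 2) (Fin k) j) = 1 := by
      ext i j
      simp [Matrix.one_apply, Pi.single_apply, eq_comm]
    have hdet : Matrix.detRowAlternating (fun j => Pi.basisFun (ZMod 2) (Fin k) j) = 1 :=
      (congrArg Matrix.det hone).trans Matrix.det_one
    rw [phiProdLinearForm_apply, LinearMap.compAlternatingMap_apply, hdet]
    simp only [linearForm_basisFun, phi_prod_X, Algebra.linearMap_apply, map_one]
  rw [h]
  rfl

theorem phi_subst_prod_X (g : GLk k) : phi k (subst k g (∏ j, X j)) = 1 := by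
  have hdet : (g : Matrix (Fin k) (Fin k) (ZMod 2)).det = 1 := by
    have hne : ∀ c : ZMod 2, c ≠ 0 → c = 1 := by decide
    exact hne _ ((Matrix.isUnit_iff_isUnit_det _).1 g.isUnit).ne_zero
  simp only [map_prod, subst_X_eq_linearForm]
  rw [← phiProdLinearForm_apply, phiProdLinearForm_eq_det, ← Matrix.det_transpose]
  exact (congrArg C hdet).trans C_1

theorem phi_subst (g : GLk k) (f : P k) : phi k (subst k g f) = subst k g (phi k f) := by
  have h : (phi k ∘ₗ (subst k g).toLinearMap) = (subst k g).toLinearMap ∘ₗ phi k := by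
    refine (basisMonomials (Fin k) (ZMod 2)).ext fun m => ?_
    obtain ⟨u, q, hu, rfl⟩ := exists_eq_add_two_nsmul m
    simp only [coe_basisMonomials, LinearMap.comp_apply, AlgHom.toLinearMap_apply,
      monomial_add_two_nsmul, map_mul, map_pow, phi_mul_sq]
    congr 1
    by_cases hone : ∀ j, u j = 1
    · rw [monomial_eq_prod_X hone, phi_subst_prod_X, phi_prod_X, map_one]
    · have hlt : u.degree < k := by
        simpa using degree_lt_card_of_le_one hu (not_forall.1 hone)
      have hhom : (monomial u 1 : P k).IsHomogeneous u.degree := isHomogeneous_monomial 1 rfl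
      rw [phi_eq_zero_of_isHomogeneous hhom hlt,
        phi_eq_zero_of_isHomogeneous (isHomogeneous_subst g hhom) hlt, map_zero]
  exact LinearMap.congr_fun h f

/-! ### The isomorphisms -/

theorem kamekoSq_qRep (g : GLk k) (z : Q k) :
    kamekoSq k (qRep k g z) = qRep k g (kamekoSq k z) := by
  obtain ⟨f, rfl⟩ := (hit k).mkQ_surjective z
  exact congrArg (hit k).mkQ (phi_subst g f)

theorem kamekoSq_pow_qRep (a : ℕ) (g : GLk k) (z : Q k) :
    (kamekoSq k ^ a) (qRep k g z) = qRep k g ((kamekoSq k ^ a) z) := by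
  have h : Commute (kamekoSq k) (qRep k g) := LinearMap.ext (kamekoSq_qRep g)
  exact LinearMap.congr_fun (h.pow_left a) z

theorem isKamekoIso_iff_injOn {t s d : ℕ} (hts : t ≤ s) :
    IsKamekoIso k t s d ↔ Set.InjOn (kamekoSq k ^ (s - t)) (qDeg k (kamekoDegree k s d)) := by
  constructor
  · rintro ⟨e, he⟩ x hx y hy hxy
    have heq : e ⟨x, hx⟩ = e ⟨y, hy⟩ :=
      Subtype.ext ((he ⟨x, hx⟩).trans (hxy.trans (he ⟨y, hy⟩).symm))
    exact congrArg Subtype.val (e.injective heq)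
  · intro hinj
    have hbij : Function.Bijective
        ((kamekoSq k ^ (s - t)).restrict (mapsTo_kamekoSq_pow hts d)) := by
      refine ⟨fun x y hxy => Subtype.ext (hinj x.2 y.2 (congrArg Subtype.val hxy)), fun y => ?_⟩
      obtain ⟨x, hx, hxy⟩ := surjOn_kamekoSq_pow hts d y.2
      exact ⟨⟨x, hx⟩, Subtype.ext hxy⟩
    exact ⟨Representation.Equiv.mk (LinearEquiv.ofBijective _ hbij) fun g =>
      LinearMap.ext fun z => Subtype.ext (kamekoSq_pow_qRep (s - t) g z), fun _ => rfl⟩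

theorem isKamekoIso_of_tBound_le {t s d : ℕ} (hd : d + k ≠ 0) (ht : tBound k d ≤ t)
    (hts : t ≤ s) : IsKamekoIso k t s d :=
  (isKamekoIso_iff_injOn hts).2 (injOn_kamekoSq_pow hd ht hts)

/-! ### Spikes -/

/-- `x^e` is a spike: each exponent has the form `2 ^ a - 1`, written without subtraction. Spikes
occur in no hit polynomial. -/
def IsSpike {σ : Type*} (e : σ →₀ ℕ) : Prop :=
  ∀ j, ∃ a, e j + 1 = 2 ^ a

theorem two_dvd_choose_of_add_add_one_eq_two_pow {a m i : ℕ} (hi : i ≠ 0)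
    (h : m + i + 1 = 2 ^ a) : 2 ∣ m.choose i := by
  induction a generalizing m i with
  | zero => rw [pow_zero] at h; omega
  | succ a ih =>
    rw [pow_succ'] at h
    have lucas := Choose.choose_modEq_choose_mod_mul_choose_div_nat (p := 2) (n := m) (k := i)
    refine (Nat.ModEq.dvd_iff lucas dvd_rfl).2 ?_
    rcases Nat.mod_two_eq_zero_or_one i with h0 | h1
    · exact Dvd.dvd.mul_left (ih (by omega) (by omega)) _
    · rw [h1, show m % 2 = 0 by omega, Nat.choose_zero_succ, zero_mul]
      exact dvd_zero 2

theorem IsSpike.monomial_notMem_hit {e : Fin k →₀ ℕ} (he : IsSpike e) :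
    (monomial e 1 : P k) ∉ hit k := by
  have hle : hit k ≤ LinearMap.ker (lcoeff (ZMod 2) e) :=
    hit_le_of_monomial fun i hi m => Sq_monomial_mem fun p hp hodd => by
      have hne : m + p ≠ e := by
        rintro rfl
        obtain ⟨j, hj⟩ : ∃ j, p j ≠ 0 := by
          by_contra! hzero
          rw [Finsupp.degree_eq_sum, Finset.sum_eq_zero fun j _ => hzero j] at hp
          omega
        obtain ⟨a, ha⟩ := he j
        exact hodd j (two_dvd_choose_of_add_add_one_eq_two_pow hj ha)
      rw [LinearMap.mem_ker, lcoeff_apply, coeff_monomial, if_neg hne]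
  intro hmem
  have hcoeff := LinearMap.mem_ker.1 (hle hmem)
  rw [lcoeff_apply, coeff_monomial, if_pos rfl] at hcoeff
  exact one_ne_zero hcoeff

theorem exists_isSpike_degree_eq {n r : ℕ} (h : alpha (n + r) = r) :
    ∃ e : Fin (r + 1) →₀ ℕ, IsSpike e ∧ e 0 = 0 ∧ e.degree = n := by
  have hsum := exists_sum_two_pow_eq (n + r)
  rw [h] at hsum
  obtain ⟨b, hb⟩ := hsum
  have hpred (i : Fin r) : 2 ^ b i - 1 + 1 = 2 ^ b i := Nat.sub_add_cancel Nat.one_le_two_pow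
  have hdegree : ∑ i, (2 ^ b i - 1) = n := by
    rw [← Finset.sum_congr rfl fun i _ => hpred i, Finset.sum_add_distrib,
      ← Finset.card_eq_sum_ones, Finset.card_fin] at hb
    exact Nat.add_right_cancel hb
  refine ⟨Finsupp.cons 0 (Finsupp.equivFunOnFinite.symm fun i => 2 ^ b i - 1), ?_,
    Finsupp.cons_zero _ _, ?_⟩
  · exact Fin.cases ⟨0, by simp⟩ fun i => ⟨b i, by simpa using hpred i⟩
  · simpa [Finsupp.degree_eq_sum, Fin.sum_univ_succ] using hdegree

theorem exists_ne_zero_kamekoSq_eq_zero {n r : ℕ} (h : alpha (n + r) = r) :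
    ∃ z ∈ qDeg (r + 1) n, z ≠ 0 ∧ kamekoSq (r + 1) z = 0 := by
  obtain ⟨e, hspike, hzero, hdegree⟩ := exists_isSpike_degree_eq h
  refine ⟨(hit (r + 1)).mkQ (monomial e 1), ⟨_, isHomogeneous_monomial 1 hdegree, rfl⟩,
    fun hclass => ?_, ?_⟩
  · exact hspike.monomial_notMem_hit ((Submodule.Quotient.mk_eq_zero _).1 hclass)
  · rw [kamekoSq_mkQ, phi_monomial_eq_zero ⟨0, by simp [hzero]⟩, map_zero]

theorem not_isKamekoIso_of_lt_tBound {t d : ℕ} (ht : (t : ℤ) < tBound k d) :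
    ¬ IsKamekoIso k t (tBound k d).toNat d := by
  set s := (tBound k d).toNat with hs
  have hk : k = alpha (d + k) + zeta (d + k) + s := by
    rw [tBound] at hs ht
    omega
  obtain ⟨a, ha⟩ : ∃ a, s - t = a + 1 := ⟨s - t - 1, by omega⟩
  obtain ⟨r, rfl⟩ : ∃ r, k = r + 1 := ⟨k - 1, by omega⟩
  have halpha : alpha (kamekoDegree (r + 1) s d + r) = r := by
    have hsucc := alpha_add_one (kamekoDegree (r + 1) s d + r)
    rw [add_assoc _ r, kamekoDegree_add, alpha_two_pow_mul, zeta_two_pow_mul s (by omega)] at hsucc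
    omega
  obtain ⟨z, hz, hne, hzero⟩ := exists_ne_zero_kamekoSq_eq_zero halpha
  rw [isKamekoIso_iff_injOn (by omega), ha, pow_succ]
  refine fun hinj => hne (hinj hz (Submodule.zero_mem _) ?_)
  rw [Module.End.mul_apply, hzero, map_zero, map_zero]

theorem isLeast_isKamekoIso {d : ℕ} (hd : d + k ≠ 0) :
    IsLeast {t : ℕ | ∀ s, t ≤ s → IsKamekoIso k t s d} (tBound k d).toNat := by
  refine ⟨fun s hs => isKamekoIso_of_tBound_le hd (Int.self_le_toNat _) hs, fun t ht => ?_⟩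
  by_contra! hlt
  exact not_isKamekoIso_of_lt_tBound (by omega) (ht _ hlt.le)

end Kameko

theorem mainTheorem6 (k : ℕ) (hk : 2 ≤ k) :
    (∀ d s : ℕ, k - 2 ≤ s → Kameko.IsKamekoIso k (k - 2) s d) ∧
    IsLeast {t : ℕ | ∀ d s : ℕ, t ≤ s → Kameko.IsKamekoIso k t s d} (k - 2) ∧
    Kameko.tBound k (2 ^ k - k + 1) = (k : ℤ) - 2 ∧
    IsLeast {t : ℕ | ∀ s : ℕ, t ≤ s → Kameko.IsKamekoIso k t s (2 ^ k - k + 1)} (k - 2) := by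
  have hiso : ∀ d s : ℕ, k - 2 ≤ s → Kameko.IsKamekoIso k (k - 2) s d := fun d s hs =>
    Kameko.isKamekoIso_of_tBound_le (by omega) (Kameko.tBound_le_sub_two hk d) hs
  have htBound := Kameko.tBound_two_pow_sub_add_one hk
  have hleast := Kameko.isLeast_isKamekoIso (k := k) (d := 2 ^ k - k + 1) (by omega)
  rw [htBound, show ((k : ℤ) - 2).toNat = k - 2 by omega] at hleast
  exact ⟨hiso, ⟨hiso, fun t ht => hleast.2 (ht _)⟩, htBound, hleast⟩
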